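/- **Setting.** All complexes are finite abstract simplicial complexes; $V(K)$ is the vertex set of $K$ and $S_i(K)$ is the set of its $i$-faces (faces with $i+1$ vertices). Every face $F$ carries an arbitrarily chosen orientation $[F]$, and for an $i$-face $F$ and an $(i+1)$-face $\bar F$ let $\operatorname{sgn}([F],\partial[\bar F])\in\{0,1,-1\}$ be the coefficient of $[F]$ in the boundary of $[\bar F]$. Faces have positive real weights $w_K$, $W_i(K)$ is the diagonal matrix of the weights of the $i$-faces, $D_i(K)=\big(\operatorname{sgn}([F],\partial[\bar F])\big)_{\bar F\in S_{i+1}(K),\,F\in S_i(K)}$ is the matrix of the coboundary map, and $\mathcal L_i^{up}(K)=W_i(K)^{-1}D_i(K)^\top W_{i+1}(K)D_i(K)$ is the matrix of the $i$-up Laplace operator. A vertex map $\phi:V(K)\to V(M)$ is a *$k$-fold (strong) covering* $K\to M$ if $K$ is connected; $\phi$ is simplicial; for every face $G$ of $M$ the faces $F$ of $K$ with $\phi(F)=G$ are mapped bijectively onto $G$, are pairwise disjoint, and have union $\{v : \phi(v)\in G\}$; whenever $G\in S_i(M)$ is contained in $\bar G\in S_{i+1}(M)$, every $F\in S_i(K)$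 with $\phi(F)=G$ is contained in some $\bar F\in S_{i+1}(K)$ with $\phi(\bar F)=\bar G$; and for all $i\ge 0$ there are exactly $k$ faces $F \in S_i(K)$ over every $G\in S_i(M)$. The incidence graph $B_i(M)$ has vertex set $S_i(M)\sqcup S_{i+1}(M)$, with $G\in S_i(M)$ and $\bar G\in S_{i+1}(M)$ adjacent iff $G\subset\bar G$. A permutation voltage assignment $\psi$ assigns to each arc $(u,v)$ of $B_i(M)$ a permutation $\psi(u,v)$ of $[k]=\{1,\dots,k\}$ with $\psi(v,u)=\psi(u,v)^{-1}$. The derived graph $B_i(M)^\psi$ has the vertices of $B_i(M)$ times $[k]$ as its vertex set, with $(u,a)$ adjacent to $(v,b)$ iff $u$ is adjacent to $v$ and $a=\psi(u,v)(b)$. **Theorem.** Let $\phi:K\to M$ be a $k$-fold covering with $w_K(F)=w_M(\phi(F))$ for all faces $F$ of $K$, and let $i\ge 0$. Let $\psi$ be a permutation voltage assignment on $B_i(M)$, and let $\eta:B_i(M)^\psi\to B_i(K)$ be a graph isomorphism which maps $S_i(M)\times[k]$ to $S_i(K)$ and $S_{i+1}(M)\times[k]$ to $S_{i+1}(K)$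 and satisfies $\phi(\eta(u,a))=u$ for all $u$ and $a$. Let $\Psi_i\le\mathbb S_k$ be the group generated by the permutations assigned by $\psi$, and for $g\in\Psi_i$ let $P^g$ be the permutation matrix with $P^g_{ab}=1$ iff $a=g(b)$. Let $\varrho_2,\dots,\varrho_t$ be irreducible complex matrix representations of $\Psi_i$ (trivial ones are allowed), and let $T$ be an invertible complex matrix such that, for all $g\in\Psi_i$, $$T^{-1}P^gT=I_1\oplus\varrho_2(g)\oplus\cdots\oplus\varrho_t(g).$$ Let $\Lambda_i(M)^\eta$ be the diagonal matrix on $S_i(M)\times[k]$ whose entry at $(G,a)$ is the sign ($\pm1$) of the $\phi$-image of the oriented face $[\eta(G,a)]$ relative to $[G]$. For $g\in\Psi_i$ let $D_i^g(M)$ be the matrix which agrees with $D_i(M)$ at the entries $(\bar G,G)$ with $G\subset\bar G$ and $\psi(\bar G,G)=g$, and is $0$ elsewhere. Index the rows and columns of $\mathcal L_i^{up}(K)$ by $S_i(M)\times[k]$ by means of $\eta$. Then $$(I\otimes T)^{-1}\,\Lambda_i(M)^\eta\,\mathcal L_i^{up}(K)\,(\Lambda_i(M)^\eta)^{-1}\,(I\otimes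 T)$$ $$=\mathcal L_i^{up}(M)\oplus\bigoplus_{j=2}^t\Big(\sum_{g\in\Psi_i}\big(W_i(M)^{-1}D_i^g(M)^\top\big)\otimes\varrho_j(g^{-1})\Big)\Big(\sum_{g\in\Psi_i}\big(W_{i+1}(M)D_i^g(M)\big)\otimes\varrho_j(g)\Big),$$ where on the right-hand side the index set is identified with that of the left-hand side by the canonical relabelling $A\otimes(B\oplus C)\cong(A\otimes B)\oplus(A\otimes C)$. -/

import Mathlib

open scoped Kronecker Matrix

noncomputable section

namespace CoveringComplex

open Matrix

/-! ### Simplicial complexes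

A finite complex `K` is an `AbstractSimplicialComplex V` over its (finite) vertex set `V`. -/

/-- The set `S_i(K)` of `i`-faces: the faces with `i + 1` vertices. -/
abbrev Face {V : Type*} (K : AbstractSimplicialComplex V) (i : ℕ) : Type _ :=
  {F : Finset V // F ∈ K ∧ F.card = i + 1}

instance instFintypeFace {V : Type*} [Finite V] (K : AbstractSimplicialComplex V) (i : ℕ) :
    Fintype (Face K i) := Fintype.ofFinite _

/-- The `1`-skeleton of `K` as a simple graph. -/
def oneSkeleton {V : Type*} [DecidableEq V] (K : AbstractSimplicialComplex V) :
    SimpleGraph V where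
  Adj u v := u ≠ v ∧ ({u, v} : Finset V) ∈ K
  symm := ⟨fun u v h => ⟨h.1.symm, by rw [Finset.pair_comm]; exact h.2⟩⟩
  loopless := ⟨fun _ h => h.1 rfl⟩

/-! ### Orientations, coboundary matrices and up Laplacians -/

/-- A choice of an orientation `[F]` of every face `F` of `K`, given by an ordering
`v_0, …, v_i` of its vertices. -/
def FaceOrientation {V : Type*} (K : AbstractSimplicialComplex V) : Type _ :=
  ∀ (i : ℕ) (F : Face K i), Fin (i + 1) ≃ F.1

/-- The ordered list of vertices `v_0, …, v_i` which defines `[F]`. -/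
def FaceOrientation.list {V : Type*} {K : AbstractSimplicialComplex V} (o : FaceOrientation K)
    {i : ℕ} (F : Face K i) : Fin (i + 1) → V :=
  fun j => (o i F j : V)

/-- The sign of the ordered simplex `b` relative to the ordered simplex `a`
(both without repeated vertices): `1` if `b` is an even rearrangement of `a`,
`-1` if it is an odd one, and `0` if `b` is not a rearrangement of `a`. -/
def orientSign {V : Type*} [DecidableEq V] {n : ℕ} (a b : Fin n → V) : ℤ :=
  ∑ σ : Equiv.Perm (Fin n), if b = a ∘ σ then (Equiv.Perm.sign σ : ℤ) else 0

/-- `sgn([F], ∂[F'])`: the coefficient of the oriented simplex `a = [F]` in the boundary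
`∑ j, (-1)^j [b_0, …, b̂_j, …, b_n]` of the oriented simplex `b = [F']`. -/
def boundarySign {V : Type*} [DecidableEq V] {n : ℕ} (a : Fin n → V) (b : Fin (n + 1) → V) : ℤ :=
  ∑ j : Fin (n + 1), (-1) ^ (j : ℕ) * orientSign a (b ∘ j.succAbove)

/-- The matrix `D_i(K)` of the coboundary map `δ_i` in the bases of elementary cochains. -/
def coboundaryMatrix {V : Type*} [DecidableEq V] {K : AbstractSimplicialComplex V}
    (o : FaceOrientation K) (i : ℕ) : Matrix (Face K (i + 1)) (Face K i) ℝ :=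
  Matrix.of fun F' F => (boundarySign (o.list F) (o.list F') : ℝ)

/-- The diagonal matrix `W_i(K)` of the weights of the `i`-faces. -/
def weightMatrix {V : Type*} [DecidableEq V] (K : AbstractSimplicialComplex V)
    (w : Finset V → ℝ) (i : ℕ) : Matrix (Face K i) (Face K i) ℝ :=
  Matrix.diagonal fun F => w F.1

/-- The matrix `W_i⁻¹ D_iᵀ W_{i+1}` of the adjoint `δ_i^*` with respect to the weighted
inner products `⟨f, g⟩ = ∑ F, w F * f [F] * g [F]`. -/
def coboundaryAdjointMatrix {V : Type*} [Finite V] [DecidableEq V]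
    {K : AbstractSimplicialComplex V} (o : FaceOrientation K) (w : Finset V → ℝ) (i : ℕ) :
    Matrix (Face K i) (Face K (i + 1)) ℝ :=
  (weightMatrix K w i)⁻¹ * (coboundaryMatrix o i)ᵀ * weightMatrix K w (i + 1)

/-- The matrix of the `i`-up Laplace operator `δ_i^* δ_i`. -/
def upLaplacian {V : Type*} [Finite V] [DecidableEq V] {K : AbstractSimplicialComplex V}
    (o : FaceOrientation K) (w : Finset V → ℝ) (i : ℕ) : Matrix (Face K i) (Face K i) ℝ :=
  coboundaryAdjointMatrix o w i * coboundaryMatrix o i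

/-! ### Coverings -/

/-- `φ : V(K) → V(M)` is a simplicial map. -/
def IsSimplicialMap {V U : Type*} [DecidableEq U] (K : AbstractSimplicialComplex V)
    (M : AbstractSimplicialComplex U) (φ : V → U) : Prop :=
  ∀ F ∈ K, F.image φ ∈ M

/-- `φ : K → M` is a covering map: `K` is connected, `φ` is simplicial, and for every face `G`
of `M` the preimage `φ⁻¹(G)` is a union of pairwise disjoint simplices of `K`, each of which is
mapped bijectively onto `G`. -/
structure IsCovering {V U : Type*} [DecidableEq V] [DecidableEq U]
    (K : AbstractSimplicialComplex V) (M : AbstractSimplicialComplex U) (φ : V → U) : Prop where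
  connected : (oneSkeleton K).Connected
  simplicial : IsSimplicialMap K M φ
  bijOn : ∀ G ∈ M, ∀ F ∈ K, F.image φ = G → Set.BijOn φ F G
  disjoint : ∀ G ∈ M, {F | F ∈ K ∧ F.image φ = G}.PairwiseDisjoint id
  covers : ∀ G ∈ M, ∀ v, φ v ∈ G → ∃ F ∈ K, F.image φ = G ∧ v ∈ F

/-- A strong covering: if `G ∈ S_i(M)` is a face of `G' ∈ S_{i+1}(M)`, then every face `F` of `K`
over `G` is a face of some `F' ∈ S_{i+1}(K)` over `G'`. -/
structure IsStrongCovering {V U : Type*} [DecidableEq V] [DecidableEq U]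
    (K : AbstractSimplicialComplex V) (M : AbstractSimplicialComplex U) (φ : V → U) : Prop
    extends IsCovering K M φ where
  lift : ∀ (i : ℕ) (G : Face M i) (G' : Face M (i + 1)), G.1 ⊆ G'.1 →
    ∀ F : Face K i, F.1.image φ = G.1 →
      ∃ F' : Face K (i + 1), F.1 ⊆ F'.1 ∧ F'.1.image φ = G'.1

/-- A `k`-fold (strong) covering: over every `i`-face of `M` there are exactly `k` faces
of dimension `i` of `K`. -/
structure IsFoldCovering {V U : Type*} [DecidableEq V] [DecidableEq U] (k : ℕ)
    (K : AbstractSimplicialComplex V) (M : AbstractSimplicialComplex U) (φ : V → U) : Prop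
    extends IsStrongCovering K M φ where
  degree : ∀ (i : ℕ) (G : Face M i), Nat.card {F : Face K i // F.1.image φ = G.1} = k

/-! ### Incidence graphs, permutation voltages and derived graphs -/

/-- The `i`-th incidence graph `B_i(K)`, with vertex set `S_i(K) ∪ S_{i+1}(K)`. -/
def incidenceGraph {V : Type*} (K : AbstractSimplicialComplex V) (i : ℕ) :
    SimpleGraph (Face K i ⊕ Face K (i + 1)) where
  Adj
    | .inl F, .inr F' => F.1 ⊆ F'.1
    | .inr F', .inl F => F.1 ⊆ F'.1
    | _, _ => False
  symm := ⟨by rintro (F | F) (F' | F') h <;> exact h⟩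
  loopless := ⟨by rintro (F | F) h <;> exact h⟩

/-- A permutation voltage assignment on a simple graph: a permutation of `[k]` for every arc,
with `ψ(e⁻¹) = ψ(e)⁻¹`. -/
structure PermVoltage {X : Type*} (G : SimpleGraph X) (k : ℕ) where
  perm : G.Dart → Equiv.Perm (Fin k)
  perm_symm : ∀ d, perm d.symm = (perm d)⁻¹

/-- The derived graph `G^ψ` on `X × [k]`: the vertices `(u, a)` and `(v, b)` are adjacent
iff `u` and `v` are and `a = ψ(u, v)(b)`. -/
def derivedGraph {X : Type*} {G : SimpleGraph X} {k : ℕ} (ψ : PermVoltage G k) :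
    SimpleGraph (X × Fin k) where
  Adj x y := ∃ h : G.Adj x.1 y.1, x.2 = ψ.perm ⟨(x.1, y.1), h⟩ y.2
  symm := ⟨by
    rintro x y ⟨h, e⟩
    refine ⟨h.symm, ?_⟩
    have := ψ.perm_symm ⟨(x.1, y.1), h⟩
    change ψ.perm ⟨(y.1, x.1), h.symm⟩ = _ at this
    simp [this, e]⟩
  loopless := ⟨fun _ h => G.loopless.irrefl _ h.1⟩

/-- An isomorphism `η : B_i(M)^ψ → B_i(K)` which maps `S_i(M) × [k]` to `S_i(K)` and
`S_{i+1}(M) × [k]` to `S_{i+1}(K)`, and is compatible with the covering map: `φ η = p`, where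
`p` is the projection of `B_i(M)^ψ` to `B_i(M)`. -/
structure DerivedIso {V U : Type*} [DecidableEq U] (K : AbstractSimplicialComplex V)
    (M : AbstractSimplicialComplex U) (φ : V → U) {i k : ℕ}
    (ψ : PermVoltage (incidenceGraph M i) k) where
  iso : derivedGraph ψ ≃g incidenceGraph K i
  isLeft : ∀ (G : Face M i) (a : Fin k), (iso (.inl G, a)).isLeft
  isRight : ∀ (G' : Face M (i + 1)) (a : Fin k), (iso (.inr G', a)).isRight
  proj_left : ∀ (G : Face M i) (a : Fin k),
    ((iso (.inl G, a)).getLeft (isLeft G a)).1.image φ = G.1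
  proj_right : ∀ (G' : Face M (i + 1)) (a : Fin k),
    ((iso (.inr G', a)).getRight (isRight G' a)).1.image φ = G'.1

/-- The restriction `S_i(M) × [k] → S_i(K)` of `η`. -/
def DerivedIso.lower {V U : Type*} [DecidableEq U] {K : AbstractSimplicialComplex V}
    {M : AbstractSimplicialComplex U} {φ : V → U} {i k : ℕ}
    {ψ : PermVoltage (incidenceGraph M i) k} (η : DerivedIso K M φ ψ)
    (x : Face M i × Fin k) : Face K i :=
  (η.iso (.inl x.1, x.2)).getLeft (η.isLeft x.1 x.2)

/-- The signature matrix `Λ_i(M)^η`: its entry at `(G, a)` is the sign of the image under `φ` of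
the oriented face `[η(G, a)]` relative to `[G]`. -/
def signature {V U : Type*} [DecidableEq U] {K : AbstractSimplicialComplex V}
    {M : AbstractSimplicialComplex U} {φ : V → U} {i k : ℕ}
    {ψ : PermVoltage (incidenceGraph M i) k} (oK : FaceOrientation K) (oM : FaceOrientation M)
    (η : DerivedIso K M φ ψ) : Matrix (Face M i × Fin k) (Face M i × Fin k) ℝ :=
  Matrix.diagonal fun x => (orientSign (oM.list x.1) (φ ∘ oK.list (η.lower x)) : ℝ)

/-! ### The voltage group and its permutation representation -/

/-- The group `Ψ_i` generated by the permutations which `ψ` assigns to the incidences of `M`. -/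
def voltageGroup {U : Type*} {M : AbstractSimplicialComplex U} {i k : ℕ}
    (ψ : PermVoltage (incidenceGraph M i) k) : Subgroup (Equiv.Perm (Fin k)) :=
  Subgroup.closure {g | ∃ (G : Face M i) (G' : Face M (i + 1))
    (h : (incidenceGraph M i).Adj (.inl G) (.inr G')), ψ.perm ⟨(.inl G, .inr G'), h⟩ = g}

instance instFintypeVoltageGroup {U : Type*} {M : AbstractSimplicialComplex U} {i k : ℕ}
    (ψ : PermVoltage (incidenceGraph M i) k) : Fintype (voltageGroup ψ) := Fintype.ofFinite _

open Classical in
/-- The matrix `D_i^g(M)`: the entries of `D_i(M)` at the incidences `(G', G)` with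
`ψ(G', G) = g`, and `0` elsewhere. -/
def coboundaryPart {U : Type*} [DecidableEq U] {M : AbstractSimplicialComplex U} {i k : ℕ}
    (o : FaceOrientation M) (ψ : PermVoltage (incidenceGraph M i) k) (g : Equiv.Perm (Fin k)) :
    Matrix (Face M (i + 1)) (Face M i) ℝ :=
  Matrix.of fun G' G =>
    if ∃ h : (incidenceGraph M i).Adj (.inr G') (.inl G), ψ.perm ⟨(.inr G', .inl G), h⟩ = g
    then coboundaryMatrix o i G' G else 0

/-- The permutation matrix `P^g`: its `(a, b)` entry is `1` iff `a = g b`. -/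
def permutationMatrix {k : ℕ} (g : Equiv.Perm (Fin k)) : Matrix (Fin k) (Fin k) ℂ :=
  Matrix.of fun a b => if a = g b then 1 else 0

/-- The linear representation on `ℂ^d` given by a matrix representation. -/
def matrixRep {Γ : Type*} [Group Γ] {d : ℕ} (ρ : Γ →* Matrix (Fin d) (Fin d) ℂ) :
    Representation ℂ Γ (Fin d → ℂ) :=
  (Matrix.toLinAlgEquiv' : Matrix (Fin d) (Fin d) ℂ ≃ₐ[ℂ] _).toAlgHom.toMonoidHom.comp ρ

/-! ### Matrices over `ℂ` and direct sums -/

/-- A real matrix regarded as a complex matrix. -/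
abbrev toComplex {X Y : Type*} (A : Matrix X Y ℝ) : Matrix X Y ℂ := A.map Complex.ofReal

/-- The direct sum `A ⊕ B_1 ⊕ ⋯ ⊕ B_m` of square matrices. -/
def directSum {m : ℕ} {X : Type*} {Y : Fin m → Type*} (A : Matrix X X ℂ)
    (B : ∀ j, Matrix (Y j) (Y j) ℂ) : Matrix (X ⊕ Σ j, Y j) (X ⊕ Σ j, Y j) ℂ :=
  Matrix.fromBlocks A 0 0 (Matrix.blockDiagonal' B)

/-- The relabelling of the rows and columns of `A ⊗ (I_1 ⊕ B_1 ⊕ ⋯ ⊕ B_m)`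
which displays it as `A ⊕ (A ⊗ B_1) ⊕ ⋯ ⊕ (A ⊗ B_m)`; `e` identifies `[k]` with the
index set of `I_1 ⊕ B_1 ⊕ ⋯ ⊕ B_m`. -/
def blockEquiv {k m : ℕ} {d : Fin m → ℕ} (X : Type*) (e : Fin k ≃ Unit ⊕ Σ j, Fin (d j)) :
    X × Fin k ≃ X ⊕ Σ j, X × Fin (d j) where
  toFun x := match e x.2 with
    | .inl _ => .inl x.1
    | .inr ⟨j, a⟩ => .inr ⟨j, (x.1, a)⟩
  invFun
    | .inl x => (x, e.symm (.inl ()))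
    | .inr ⟨j, (x, a)⟩ => (x, e.symm (.inr ⟨j, a⟩))
  left_inv := by
    rintro ⟨x, a⟩
    obtain ⟨s, rfl⟩ := e.symm.surjective a
    rcases s with _ | ⟨j, b⟩ <;> simp
  right_inv := by
    rintro (x | ⟨j, x, b⟩) <;> simp

end CoveringComplex

end

open CoveringComplex

/-!
Label the `i`- and `(i+1)`-faces of `K` by `S_i(M) × [k]` and `S_{i+1}(M) × [k]` through `η`, and
change the sign of every label at which the covering reverses the chosen orientation. In these
labels the coboundary matrix of `K` is `∑ g, D_i^g(M) ⊗ P^g`, since `(G, a)` and `(G', b)` are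
incident exactly when `G ⊂ G'` and `b = ψ(G', G)(a)`, and the covering carries boundary signs to
boundary signs. The weight matrices become `W ⊗ 1`, so the up Laplacian of `K` is the up Laplacian
of `M` twisted by the permutation representation. Twisting is compatible with conjugating and with
decomposing the representation, and twisting by the trivial one gives the up Laplacian of `M`.
-/

noncomputable section

namespace CoveringComplex

open Matrix

section Signs

variable {V : Type*} [DecidableEq V] {n : ℕ}

theorem orientSign_eq_det (a b : Fin n → V) :
    orientSign a b = ((1 : Matrix V V ℤ).submatrix a b).det := by
  simp [orientSign, det_apply', one_apply, Finset.prod_boole, funext_iff, eq_comm]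

theorem orientSign_comp_left (a b : Fin n → V) (σ : Equiv.Perm (Fin n)) :
    orientSign (a ∘ σ) b = Equiv.Perm.sign σ * orientSign a b := by
  simpa [orientSign_eq_det] using det_permute σ ((1 : Matrix V V ℤ).submatrix a b)

theorem orientSign_comp_self {a : Fin n → V} (ha : Function.Injective a)
    (σ : Equiv.Perm (Fin n)) : orientSign a (a ∘ σ) = Equiv.Perm.sign σ := by
  have h := det_permute' σ ((1 : Matrix V V ℤ).submatrix a a)
  rwa [submatrix_one a ha, det_one, mul_one, ← submatrix_one a ha, submatrix_submatrix,
    Function.comp_id, ← orientSign_eq_det] at h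

/-- The coincidence matrix of the lists `a` and `b`, with a row of ones added on top. Expanding its
determinant along that row gives the alternating sum over the entries omitted from `b`. -/
def augmentedCoincidenceMatrix (a : Fin n → V) (b : Fin (n + 1) → V) :
    Matrix (Fin (n + 1)) (Fin (n + 1)) ℤ :=
  Matrix.of (vecCons 1 ((1 : Matrix V V ℤ).submatrix a b))

theorem boundarySign_eq_det (a : Fin n → V) (b : Fin (n + 1) → V) :
    boundarySign a b = (augmentedCoincidenceMatrix a b).det := by
  rw [det_succ_row_zero, boundarySign]
  refine Finset.sum_congr rfl fun j _ => ?_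
  rw [orientSign_eq_det, show augmentedCoincidenceMatrix a b 0 j = 1 from rfl, mul_one]
  rfl

theorem boundarySign_comp_left (a : Fin n → V) (b : Fin (n + 1) → V) (σ : Equiv.Perm (Fin n)) :
    boundarySign (a ∘ σ) b = Equiv.Perm.sign σ * boundarySign a b := by
  simp only [boundarySign, orientSign_comp_left, Finset.mul_sum, mul_left_comm]

theorem boundarySign_comp_right (a : Fin n → V) (b : Fin (n + 1) → V)
    (τ : Equiv.Perm (Fin (n + 1))) :
    boundarySign a (b ∘ τ) = Equiv.Perm.sign τ * boundarySign a b := by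
  have hsub : augmentedCoincidenceMatrix a (b ∘ τ) =
      (augmentedCoincidenceMatrix a b).submatrix id τ := by
    ext p q
    cases p using Fin.cases <;> rfl
  simpa only [boundarySign_eq_det, hsub, Int.cast_id] using
    det_permute' τ (augmentedCoincidenceMatrix a b)

theorem range_subset_of_boundarySign_ne_zero {a : Fin n → V} {b : Fin (n + 1) → V}
    (h : boundarySign a b ≠ 0) : Set.range a ⊆ Set.range b := by
  rintro _ ⟨p, rfl⟩
  by_contra hp
  rw [boundarySign_eq_det] at h
  exact h (det_eq_zero_of_row_eq_zero p.succ fun q => one_apply_ne fun hq => hp ⟨q, hq.symm⟩)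

theorem boundarySign_map {U : Type*} [DecidableEq U] {a : Fin n → V} {b : Fin (n + 1) → V}
    {φ : V → U} {s : Set V} (hφ : Set.InjOn φ s) (ha : ∀ p, a p ∈ s) (hb : ∀ q, b q ∈ s) :
    boundarySign (φ ∘ a) (φ ∘ b) = boundarySign a b := by
  rw [boundarySign_eq_det, boundarySign_eq_det]
  congr 1
  ext p q
  cases p using Fin.cases with
  | zero => rfl
  | succ p =>
    change (1 : Matrix U U ℤ) (φ (a p)) (φ (b q)) = (1 : Matrix V V ℤ) (a p) (b q)
    simp only [one_apply, hφ.eq_iff (ha p) (hb q)]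

end Signs

theorem exists_perm_comp_eq_of_range_eq {ι X : Type*} {a b : ι → X} (ha : Function.Injective a)
    (hb : Function.Injective b) (h : Set.range b = Set.range a) :
    ∃ σ : Equiv.Perm ι, b = a ∘ σ :=
  ⟨(Equiv.ofInjective b hb).trans
      ((Equiv.setCongr h).trans (Equiv.ofInjective a ha).symm),
    funext fun p => (Equiv.apply_ofInjective_symm ha ⟨b p, h ▸ Set.mem_range_self p⟩).symm⟩

section Faces

variable {V U : Type*} {K : AbstractSimplicialComplex V} {M : AbstractSimplicialComplex U} {i : ℕ}

theorem FaceOrientation.list_injective (o : FaceOrientation K) (F : Face K i) :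
    Function.Injective (o.list F) :=
  Subtype.val_injective.comp (o i F).injective

theorem FaceOrientation.range_list (o : FaceOrientation K) (F : Face K i) :
    Set.range (o.list F) = F.1 :=
  ((o i F).surjective.range_comp Subtype.val).trans Subtype.range_coe

theorem FaceOrientation.list_mem (o : FaceOrientation K) (F : Face K i) (p : Fin (i + 1)) :
    o.list F p ∈ F.1 :=
  (o i F p).2

theorem coboundaryMatrix_eq_zero [DecidableEq V] (o : FaceOrientation K) {F' : Face K (i + 1)}
    {F : Face K i} (h : ¬F.1 ⊆ F'.1) : coboundaryMatrix o i F' F = 0 := by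
  contrapose! h
  have hsgn : boundarySign (o.list F) (o.list F') ≠ 0 := fun h₀ =>
    h (by simp [coboundaryMatrix, h₀])
  simpa only [o.range_list, Finset.coe_subset] using range_subset_of_boundarySign_ne_zero hsgn

variable [DecidableEq U] {φ : V → U}

theorem injOn_of_image_eq {F : Face K i} {G : Face M i} (h : F.1.image φ = G.1) :
    Set.InjOn φ F.1 := by
  rw [← Finset.card_image_iff, h, G.2.2, F.2.2]

variable (oK : FaceOrientation K) (oM : FaceOrientation M)

/-- The sign of the image under `φ` of the oriented face `[F]` relative to `[G]`. -/
def relativeSign (φ : V → U) (F : Face K i) (G : Face M i) : ℤ :=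
  orientSign (oM.list G) (φ ∘ oK.list F)

theorem exists_perm_relativeSign_eq_sign {F : Face K i} {G : Face M i} (h : F.1.image φ = G.1) :
    ∃ σ : Equiv.Perm (Fin (i + 1)), φ ∘ oK.list F = oM.list G ∘ σ ∧
      relativeSign oK oM φ F G = Equiv.Perm.sign σ := by
  have hinj : Function.Injective (φ ∘ oK.list F) := fun p q hpq =>
    oK.list_injective F (injOn_of_image_eq h (oK.list_mem F p) (oK.list_mem F q) hpq)
  have hrange : Set.range (φ ∘ oK.list F) = Set.range (oM.list G) := by
    rw [Set.range_comp, oK.range_list, oM.range_list, ← h, Finset.coe_image]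
  obtain ⟨σ, hσ⟩ := exists_perm_comp_eq_of_range_eq (oM.list_injective G) hinj hrange
  exact ⟨σ, hσ, by rw [relativeSign, hσ, orientSign_comp_self (oM.list_injective G)]⟩

theorem relativeSign_mul_self {F : Face K i} {G : Face M i} (h : F.1.image φ = G.1) :
    relativeSign oK oM φ F G * relativeSign oK oM φ F G = 1 := by
  obtain ⟨σ, -, hσ⟩ := exists_perm_relativeSign_eq_sign oK oM h
  rw [hσ, Int.units_coe_mul_self]

theorem boundarySign_list_eq [DecidableEq V] {F : Face K i} {G : Face M i} {F' : Face K (i + 1)}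
    {G' : Face M (i + 1)} (h : F.1.image φ = G.1) (h' : F'.1.image φ = G'.1) (hF : F.1 ⊆ F'.1) :
    boundarySign (oK.list F) (oK.list F') = relativeSign oK oM φ F' G' *
      boundarySign (oM.list G) (oM.list G') * relativeSign oK oM φ F G := by
  obtain ⟨σ, hσ, hsign⟩ := exists_perm_relativeSign_eq_sign oK oM h
  obtain ⟨τ, hτ, hsign'⟩ := exists_perm_relativeSign_eq_sign oK oM h'
  rw [← boundarySign_map (injOn_of_image_eq h') (fun p => hF (oK.list_mem F p)) (oK.list_mem F'),
    hσ, hτ, boundarySign_comp_left, boundarySign_comp_right, hsign, hsign', mul_comm]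

theorem relativeSign_mul_coboundaryMatrix [DecidableEq V] {F : Face K i} {G : Face M i}
    {F' : Face K (i + 1)} {G' : Face M (i + 1)} (h : F.1.image φ = G.1)
    (h' : F'.1.image φ = G'.1) (hF : F.1 ⊆ F'.1) :
    relativeSign oK oM φ F' G' * coboundaryMatrix oK i F' F * relativeSign oK oM φ F G =
      coboundaryMatrix oM i G' G := by
  have hs := relativeSign_mul_self oK oM h
  have hs' := relativeSign_mul_self oK oM h'
  simp only [coboundaryMatrix, of_apply, boundarySign_list_eq oK oM h h' hF]
  norm_cast
  linear_combination boundarySign (oM.list G) (oM.list G') *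
    (relativeSign oK oM φ F' G' * relativeSign oK oM φ F' G' * hs + hs')

end Faces

theorem inv_weightMatrix {V : Type*} [Finite V] [DecidableEq V] {K : AbstractSimplicialComplex V}
    {w : Finset V → ℝ} {i : ℕ} (hw : ∀ F : Face K i, w F.1 ≠ 0) :
    (weightMatrix K w i)⁻¹ = diagonal fun F => (w F.1)⁻¹ := by
  refine inv_eq_left_inv ?_
  simp only [weightMatrix, diagonal_mul_diagonal, inv_mul_cancel₀ (hw _), diagonal_one]

section Relabelling

variable {V U : Type*} [DecidableEq U] {K : AbstractSimplicialComplex V}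
  {M : AbstractSimplicialComplex U} {φ : V → U} {i k : ℕ}
  {ψ : PermVoltage (incidenceGraph M i) k} (η : DerivedIso K M φ ψ)

/-- The restriction `S_{i+1}(M) × [k] → S_{i+1}(K)` of `η`. -/
def DerivedIso.upper (y : Face M (i + 1) × Fin k) : Face K (i + 1) :=
  (η.iso (.inr y.1, y.2)).getRight (η.isRight y.1 y.2)

theorem DerivedIso.iso_inl (x : Face M i × Fin k) : η.iso (.inl x.1, x.2) = .inl (η.lower x) := by
  simp [DerivedIso.lower]

theorem DerivedIso.iso_inr (y : Face M (i + 1) × Fin k) :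
    η.iso (.inr y.1, y.2) = .inr (η.upper y) := by
  simp [DerivedIso.upper]

theorem DerivedIso.bijective_lower_and_upper :
    Function.Bijective η.lower ∧ Function.Bijective η.upper := by
  have hmap : Sum.map η.lower η.upper = η.iso ∘ (Equiv.sumProdDistrib _ _ _).symm :=
    funext fun
      | .inl x => (η.iso_inl x).symm
      | .inr y => (η.iso_inr y).symm
  rw [← Sum.map_bijective, hmap]
  exact η.iso.bijective.comp (Equiv.bijective _)

/-- The labelling of `S_i(K)` by `S_i(M) × [k]`. -/
def DerivedIso.lowerEquiv : Face M i × Fin k ≃ Face K i :=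
  Equiv.ofBijective η.lower η.bijective_lower_and_upper.1

/-- The labelling of `S_{i+1}(K)` by `S_{i+1}(M) × [k]`. -/
def DerivedIso.upperEquiv : Face M (i + 1) × Fin k ≃ Face K (i + 1) :=
  Equiv.ofBijective η.upper η.bijective_lower_and_upper.2

theorem DerivedIso.lower_subset_upper_iff (x : Face M i × Fin k) (y : Face M (i + 1) × Fin k) :
    (η.lower x).1 ⊆ (η.upper y).1 ↔ (derivedGraph ψ).Adj (.inr y.1, y.2) (.inl x.1, x.2) := by
  rw [← η.iso.map_adj_iff, η.iso_inl, η.iso_inr]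
  rfl

variable (oK : FaceOrientation K) (oM : FaceOrientation M)

/-- The signature matrix of the `(i+1)`-faces, the counterpart of `signature` one dimension up. -/
def upperSignature : Matrix (Face M (i + 1) × Fin k) (Face M (i + 1) × Fin k) ℝ :=
  diagonal fun y => (relativeSign oK oM φ (η.upper y) y.1 : ℝ)

theorem signature_mul_self [Finite U] : signature oK oM η * signature oK oM η = 1 := by
  rw [signature, diagonal_mul_diagonal, ← diagonal_one]
  congr! 2 with x
  exact_mod_cast relativeSign_mul_self oK oM (η.proj_left x.1 x.2)

theorem upperSignature_mul_self [Finite U] :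
    upperSignature η oK oM * upperSignature η oK oM = 1 := by
  rw [upperSignature, diagonal_mul_diagonal, ← diagonal_one]
  congr! 2 with y
  exact_mod_cast relativeSign_mul_self oK oM (η.proj_right y.1 y.2)

variable [DecidableEq V]

/-- The coboundary matrix of `K` in the labels given by `η`, with every face of `K` oriented so that
`φ` preserves orientations. -/
def liftedCoboundary [Finite U] : Matrix (Face M (i + 1) × Fin k) (Face M i × Fin k) ℝ :=
  upperSignature η oK oM * (coboundaryMatrix oK i).submatrix η.upper η.lower * signature oK oM η

open Classical in
theorem liftedCoboundary_apply [Finite U] (y : Face M (i + 1) × Fin k) (x : Face M i × Fin k) :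
    liftedCoboundary η oK oM y x =
      if (derivedGraph ψ).Adj (.inr y.1, y.2) (.inl x.1, x.2) then coboundaryMatrix oM i y.1 x.1
      else 0 := by
  rw [liftedCoboundary, upperSignature, signature, mul_diagonal, diagonal_mul, submatrix_apply,
    ← η.lower_subset_upper_iff]
  split_ifs with h
  · exact relativeSign_mul_coboundaryMatrix oK oM (η.proj_left x.1 x.2) (η.proj_right y.1 y.2) h
  · rw [coboundaryMatrix_eq_zero oK h, mul_zero, zero_mul]

variable {wK : Finset V → ℝ} {wM : Finset U → ℝ}

theorem weightMatrix_submatrix_lower (hw : ∀ F ∈ K, wK F = wM (F.image φ)) :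
    (weightMatrix K wK i).submatrix η.lower η.lower =
      weightMatrix M wM i ⊗ₖ (1 : Matrix (Fin k) (Fin k) ℝ) := by
  rw [weightMatrix, weightMatrix, submatrix_diagonal _ _ η.bijective_lower_and_upper.1.1,
    ← diagonal_one, diagonal_kronecker_diagonal]
  congr! 2 with x
  rw [Function.comp_apply, hw _ (η.lower x).2.1, mul_one]
  exact congrArg wM (η.proj_left x.1 x.2)

theorem weightMatrix_submatrix_upper (hw : ∀ F ∈ K, wK F = wM (F.image φ)) :
    (weightMatrix K wK (i + 1)).submatrix η.upper η.upper =
      weightMatrix M wM (i + 1) ⊗ₖ (1 : Matrix (Fin k) (Fin k) ℝ) := by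
  rw [weightMatrix, weightMatrix, submatrix_diagonal _ _ η.bijective_lower_and_upper.2.1,
    ← diagonal_one, diagonal_kronecker_diagonal]
  congr! 2 with y
  rw [Function.comp_apply, hw _ (η.upper y).2.1, mul_one]
  exact congrArg wM (η.proj_right y.1 y.2)

variable [Finite V] [Finite U]

theorem upLaplacian_submatrix_lower (hw : ∀ F ∈ K, wK F = wM (F.image φ)) :
    (upLaplacian oK wK i).submatrix η.lower η.lower =
      ((weightMatrix M wM i)⁻¹ ⊗ₖ (1 : Matrix (Fin k) (Fin k) ℝ)) *
        ((coboundaryMatrix oK i).submatrix η.upper η.lower)ᵀ *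
        (weightMatrix M wM (i + 1) ⊗ₖ (1 : Matrix (Fin k) (Fin k) ℝ)) *
        (coboundaryMatrix oK i).submatrix η.upper η.lower := by
  have hinv : (weightMatrix K wK i)⁻¹.submatrix η.lowerEquiv η.lowerEquiv =
      (weightMatrix M wM i)⁻¹ ⊗ₖ (1 : Matrix (Fin k) (Fin k) ℝ) := by
    rw [← inv_submatrix_equiv, show (weightMatrix K wK i).submatrix η.lowerEquiv η.lowerEquiv = _
      from weightMatrix_submatrix_lower η hw, inv_kronecker, inv_one]
  rw [← hinv, ← weightMatrix_submatrix_upper η hw, transpose_submatrix]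
  change _ = _ * (coboundaryMatrix oK i)ᵀ.submatrix η.lowerEquiv η.upperEquiv *
    (weightMatrix K wK (i + 1)).submatrix η.upperEquiv η.upperEquiv *
    (coboundaryMatrix oK i).submatrix η.upperEquiv η.lowerEquiv
  simp only [submatrix_mul_equiv]
  rfl

theorem signature_mul_upLaplacian_mul_signature (hwM : ∀ G : Face M i, wM G.1 ≠ 0)
    (hw : ∀ F ∈ K, wK F = wM (F.image φ)) :
    signature oK oM η * (upLaplacian oK wK i).submatrix η.lower η.lower * signature oK oM η =
      ((weightMatrix M wM i)⁻¹ ⊗ₖ (1 : Matrix (Fin k) (Fin k) ℝ)) *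
        (liftedCoboundary η oK oM)ᵀ *
        ((weightMatrix M wM (i + 1) ⊗ₖ (1 : Matrix (Fin k) (Fin k) ℝ)) *
          liftedCoboundary η oK oM) := by
  set Λ := signature oK oM η with hΛ
  set Λ' := upperSignature η oK oM with hΛ'
  set D := (coboundaryMatrix oK i).submatrix η.upper η.lower
  set W := (weightMatrix M wM i)⁻¹ ⊗ₖ (1 : Matrix (Fin k) (Fin k) ℝ) with hW
  set W' := weightMatrix M wM (i + 1) ⊗ₖ (1 : Matrix (Fin k) (Fin k) ℝ) with hW'
  have hcomm : Λ * W = W * Λ := by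
    rw [hΛ, signature, hW, inv_weightMatrix hwM, ← diagonal_one, diagonal_kronecker_diagonal]
    exact commute_diagonal _ _
  have hcomm' : Λ' * W' = W' * Λ' := by
    rw [hΛ', upperSignature, hW', weightMatrix, ← diagonal_one, diagonal_kronecker_diagonal]
    exact commute_diagonal _ _
  have htrans : (liftedCoboundary η oK oM)ᵀ = Λ * Dᵀ * Λ' := by
    simp only [liftedCoboundary, transpose_mul, Λ, Λ', signature, upperSignature,
      diagonal_transpose, D, Matrix.mul_assoc]
  calc Λ * (upLaplacian oK wK i).submatrix η.lower η.lower * Λ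
      = Λ * W * Dᵀ * W' * D * Λ := by
        rw [upLaplacian_submatrix_lower η oK hw]
        simp only [Matrix.mul_assoc, W, W', D]
    _ = W * Λ * Dᵀ * (Λ' * Λ') * W' * D * Λ := by
        rw [hcomm, upperSignature_mul_self, Matrix.mul_one]
    _ = W * (Λ * Dᵀ * Λ') * (Λ' * W') * D * Λ := by simp only [Matrix.mul_assoc]
    _ = W * (liftedCoboundary η oK oM)ᵀ * (W' * liftedCoboundary η oK oM) := by
        rw [hcomm', htrans, liftedCoboundary]
        simp only [Matrix.mul_assoc, Λ, Λ', D]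

end Relabelling

section ToComplex

variable {X Y Z : Type*}

theorem toComplex_mul [Fintype Y] (A : Matrix X Y ℝ) (B : Matrix Y Z ℝ) :
    toComplex (A * B) = toComplex A * toComplex B :=
  Matrix.map_mul (f := Complex.ofRealHom)

theorem toComplex_sum {ι : Type*} (s : Finset ι) (A : ι → Matrix X Y ℝ) :
    toComplex (∑ g ∈ s, A g) = ∑ g ∈ s, toComplex (A g) :=
  map_sum Complex.ofRealHom.toAddMonoidHom.mapMatrix A s

theorem toComplex_kronecker_one_mul_kronecker {n : Type*} [Fintype n] [DecidableEq n] [Fintype Y]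
    (A : Matrix X Y ℝ) (B : Matrix Y Z ℝ) (P : Matrix n n ℂ) :
    toComplex (A ⊗ₖ (1 : Matrix n n ℝ)) * (toComplex B ⊗ₖ P) = toComplex (A * B) ⊗ₖ P := by
  have hA : toComplex (A ⊗ₖ (1 : Matrix n n ℝ)) = toComplex A ⊗ₖ (1 : Matrix n n ℂ) := by
    ext ⟨x, a⟩ ⟨y, b⟩
    simp [one_apply, apply_ite Complex.ofReal]
  rw [hA, ← mul_kronecker_mul, Matrix.one_mul, toComplex_mul]

theorem inv_toComplex_of_mul_self [Fintype X] [DecidableEq X] {A : Matrix X X ℝ}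
    (hA : A * A = 1) : (toComplex A)⁻¹ = toComplex A := by
  refine inv_eq_left_inv ?_
  rw [← toComplex_mul, hA]
  exact Matrix.map_one _ Complex.ofReal_zero Complex.ofReal_one

end ToComplex

section Voltage

variable {U : Type*} {M : AbstractSimplicialComplex U} {i k : ℕ}
  (ψ : PermVoltage (incidenceGraph M i) k)

/-- The voltage `ψ(G', G)` of an incidence, as an element of the voltage group. -/
def incidenceVoltage {G' : Face M (i + 1)} {G : Face M i}
    (h : (incidenceGraph M i).Adj (.inr G') (.inl G)) : voltageGroup ψ where
  val := ψ.perm ⟨(.inr G', .inl G), h⟩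
  property := by
    rw [← inv_mem_iff, ← ψ.perm_symm]
    exact Subgroup.subset_closure ⟨G, G', h.symm, rfl⟩

variable [DecidableEq U] (o : FaceOrientation M)

open Classical in
theorem coboundaryPart_apply (g : voltageGroup ψ) {G' : Face M (i + 1)} {G : Face M i}
    (h : (incidenceGraph M i).Adj (.inr G') (.inl G)) :
    coboundaryPart o ψ g G' G =
      if incidenceVoltage ψ h = g then coboundaryMatrix o i G' G else 0 := by
  simp [coboundaryPart, incidenceVoltage, Subtype.ext_iff, h]

theorem coboundaryPart_eq_zero (g : Equiv.Perm (Fin k)) {G' : Face M (i + 1)} {G : Face M i}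
    (h : ¬(incidenceGraph M i).Adj (.inr G') (.inl G)) : coboundaryPart o ψ g G' G = 0 :=
  if_neg fun h' => h h'.1

theorem sum_coboundaryPart :
    ∑ g : voltageGroup ψ, coboundaryPart o ψ (g : Equiv.Perm (Fin k)) = coboundaryMatrix o i := by
  classical
  ext G' G
  rw [Matrix.sum_apply]
  by_cases h : (incidenceGraph M i).Adj (.inr G') (.inl G)
  · simp only [coboundaryPart_apply ψ o _ h, Finset.sum_ite_eq, Finset.mem_univ, if_true]
  · simp only [coboundaryPart_eq_zero ψ o _ h, Finset.sum_const_zero, coboundaryMatrix_eq_zero o h]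

theorem transpose_permutationMatrix (g : Equiv.Perm (Fin k)) :
    (permutationMatrix g)ᵀ = permutationMatrix g⁻¹ := by
  ext a b
  simp only [permutationMatrix, transpose_apply, of_apply, Equiv.Perm.eq_inv_iff_eq, eq_comm]

variable {ψ} in
theorem toComplex_liftedCoboundary [Finite U] {V : Type*} [DecidableEq V]
    {K : AbstractSimplicialComplex V} {φ : V → U} (η : DerivedIso K M φ ψ)
    (oK : FaceOrientation K) :
    toComplex (liftedCoboundary η oK o) = ∑ g : voltageGroup ψ,
      toComplex (coboundaryPart o ψ g) ⊗ₖ permutationMatrix (g : Equiv.Perm (Fin k)) := by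
  classical
  ext ⟨G', b⟩ ⟨G, a⟩
  simp only [map_apply, liftedCoboundary_apply, Matrix.sum_apply, kronecker_apply]
  by_cases h : (incidenceGraph M i).Adj (.inr G') (.inl G)
  · have hadj : (derivedGraph ψ).Adj (.inr G', b) (.inl G, a) ↔
        b = (incidenceVoltage ψ h : Equiv.Perm (Fin k)) a := exists_prop_of_true h
    simp only [coboundaryPart_apply ψ o _ h, apply_ite Complex.ofReal, Complex.ofReal_zero,
      ite_mul, zero_mul, Finset.sum_ite_eq, Finset.mem_univ, if_true, hadj]
    simp only [permutationMatrix, of_apply, mul_ite, mul_one, mul_zero]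
  · simp [coboundaryPart_eq_zero ψ o _ h, derivedGraph, h]

end Voltage

section TwistedLaplacian

variable {U : Type*} [Finite U] [DecidableEq U] {M : AbstractSimplicialComplex U} {i k : ℕ}
  (o : FaceOrientation M) (w : Finset U → ℝ) (ψ : PermVoltage (incidenceGraph M i) k)

/-- The `i`-up Laplacian of `M` twisted by the family of matrices `ρ`: each incidence `(G', G)` of
`M` is weighted by the matrix `ρ (ψ(G', G))`. It is meant for matrix representations `ρ` of the
voltage group. -/
def twistedUpLaplacian {n : Type*} [Fintype n] (ρ : voltageGroup ψ → Matrix n n ℂ) :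
    Matrix (Face M i × n) (Face M i × n) ℂ :=
  (∑ g : voltageGroup ψ,
      toComplex ((weightMatrix M w i)⁻¹ * (coboundaryPart o ψ (g : Equiv.Perm (Fin k)))ᵀ)
        ⊗ₖ ρ g⁻¹) *
    (∑ g : voltageGroup ψ,
      toComplex (weightMatrix M w (i + 1) * coboundaryPart o ψ (g : Equiv.Perm (Fin k))) ⊗ₖ ρ g)

theorem one_kronecker_conj_sum {X Y ι n : Type*} [Fintype X] [DecidableEq X] [Fintype Y]
    [DecidableEq Y] [Fintype n] [DecidableEq n] (s : Finset ι) (A : ι → Matrix X Y ℂ)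
    (P : ι → Matrix n n ℂ) (T : Matrix n n ℂ) :
    ((1 : Matrix X X ℂ) ⊗ₖ T)⁻¹ * (∑ g ∈ s, A g ⊗ₖ P g) * ((1 : Matrix Y Y ℂ) ⊗ₖ T) =
      ∑ g ∈ s, A g ⊗ₖ (T⁻¹ * P g * T) := by
  simp only [inv_kronecker, inv_one, Matrix.mul_sum, Matrix.sum_mul, ← mul_kronecker_mul,
    Matrix.one_mul, Matrix.mul_one]

theorem one_kronecker_conj_twistedUpLaplacian {n : Type*} [Fintype n] [DecidableEq n]
    (ρ : voltageGroup ψ → Matrix n n ℂ) {T : Matrix n n ℂ} (hT : IsUnit T) :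
    ((1 : Matrix (Face M i) (Face M i) ℂ) ⊗ₖ T)⁻¹ * twistedUpLaplacian o w ψ ρ *
        ((1 : Matrix (Face M i) (Face M i) ℂ) ⊗ₖ T) =
      twistedUpLaplacian o w ψ fun g => T⁻¹ * ρ g * T := by
  set S : Matrix (Face M (i + 1) × n) (Face M (i + 1) × n) ℂ := 1 ⊗ₖ T
  have hS : IsUnit S.det := by
    rw [det_kronecker, det_one, one_pow, one_mul]
    exact ((isUnit_iff_isUnit_det T).mp hT).pow _
  rw [twistedUpLaplacian, twistedUpLaplacian, ← one_kronecker_conj_sum, ← one_kronecker_conj_sum]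
  simp only [Matrix.mul_assoc]
  rw [mul_nonsing_inv_cancel_left S _ hS]

theorem sum_kronecker_directSum {X Y ι : Type*} {m : ℕ} {d : Fin m → ℕ}
    (e : Fin k ≃ Unit ⊕ Σ j, Fin (d j)) (s : Finset ι) (A : ι → Matrix X Y ℂ)
    (B : ∀ j, ι → Matrix (Fin (d j)) (Fin (d j)) ℂ) :
    ∑ g ∈ s, A g ⊗ₖ (directSum (1 : Matrix Unit Unit ℂ) fun j => B j g).submatrix e e =
      (fromBlocks (∑ g ∈ s, A g) 0 0 (blockDiagonal' fun j => ∑ g ∈ s, A g ⊗ₖ B j g)).submatrix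
        (blockEquiv X e) (blockEquiv Y e) := by
  ext ⟨x, a⟩ ⟨y, b⟩
  obtain ⟨a, rfl⟩ := e.symm.surjective a
  obtain ⟨b, rfl⟩ := e.symm.surjective b
  rcases a with a | ⟨j, a⟩ <;> rcases b with b | ⟨l, b⟩
  · simp [Matrix.sum_apply, directSum, blockEquiv]
  · simp [Matrix.sum_apply, directSum, blockEquiv]
  · simp [Matrix.sum_apply, directSum, blockEquiv]
  · obtain rfl | h := eq_or_ne j l
    · simp [Matrix.sum_apply, directSum, blockEquiv, blockDiagonal'_apply]
    · simp [Matrix.sum_apply, directSum, blockEquiv, blockDiagonal'_apply, h]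

theorem twistedUpLaplacian_directSum {m : ℕ} {d : Fin m → ℕ} (e : Fin k ≃ Unit ⊕ Σ j, Fin (d j))
    (ρ : ∀ j, voltageGroup ψ → Matrix (Fin (d j)) (Fin (d j)) ℂ) :
    (twistedUpLaplacian o w ψ fun g =>
        (directSum (1 : Matrix Unit Unit ℂ) fun j => ρ j g).submatrix e e) =
      (directSum (toComplex (upLaplacian o w i)) fun j =>
        twistedUpLaplacian o w ψ (ρ j)).submatrix
          (blockEquiv (Face M i) e) (blockEquiv (Face M i) e) := by
  have htrivial : (∑ g : voltageGroup ψ,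
        toComplex ((weightMatrix M w i)⁻¹ * (coboundaryPart o ψ (g : Equiv.Perm (Fin k)))ᵀ)) *
      (∑ g : voltageGroup ψ,
        toComplex (weightMatrix M w (i + 1) * coboundaryPart o ψ (g : Equiv.Perm (Fin k)))) =
      toComplex (upLaplacian o w i) := by
    simp only [← toComplex_sum, ← Matrix.mul_sum, ← transpose_sum, sum_coboundaryPart,
      ← toComplex_mul, upLaplacian, coboundaryAdjointMatrix, Matrix.mul_assoc]
  rw [twistedUpLaplacian, sum_kronecker_directSum e _ _ fun j (g : voltageGroup ψ) => ρ j g⁻¹,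
    sum_kronecker_directSum e, submatrix_mul_equiv, fromBlocks_multiply, ← blockDiagonal'_mul]
  simp only [htrivial, Matrix.mul_zero, Matrix.zero_mul, add_zero, zero_add]
  rfl

variable {V : Type*} [Finite V] [DecidableEq V] {K : AbstractSimplicialComplex V} {φ : V → U}
  {w ψ} (η : DerivedIso K M φ ψ) (oK : FaceOrientation K)

theorem signature_conj_upLaplacian {wK : Finset V → ℝ}
    (hwM : ∀ G : Face M i, w G.1 ≠ 0) (hw : ∀ F ∈ K, wK F = w (F.image φ)) :
    toComplex (signature oK o η) * toComplex ((upLaplacian oK wK i).submatrix η.lower η.lower) *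
        (toComplex (signature oK o η))⁻¹ =
      twistedUpLaplacian o w ψ fun g => permutationMatrix (g : Equiv.Perm (Fin k)) := by
  have htrans : toComplex (liftedCoboundary η oK o)ᵀ = ∑ g : voltageGroup ψ,
      toComplex (coboundaryPart o ψ g)ᵀ ⊗ₖ
        permutationMatrix ((g⁻¹ : voltageGroup ψ) : Equiv.Perm (Fin k)) := by
    simp only [transpose_map, toComplex_liftedCoboundary, transpose_sum, ← kroneckerMap_transpose,
      transpose_permutationMatrix, InvMemClass.coe_inv]
  rw [inv_toComplex_of_mul_self (signature_mul_self η oK o), ← toComplex_mul, ← toComplex_mul,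
    signature_mul_upLaplacian_mul_signature η oK o hwM hw, toComplex_mul, toComplex_mul,
    toComplex_mul, htrans, toComplex_liftedCoboundary, twistedUpLaplacian]
  simp only [Matrix.mul_sum, toComplex_kronecker_one_mul_kronecker]

end TwistedLaplacian

end CoveringComplex

end

theorem theorem1p4_general
    {V U : Type*} [Finite V] [DecidableEq V] [Finite U] [DecidableEq U]
    {K : AbstractSimplicialComplex V} {M : AbstractSimplicialComplex U}
    (oK : FaceOrientation K) (oM : FaceOrientation M) {wK : Finset V → ℝ} {wM : Finset U → ℝ}
    {φ : V → U} {i k : ℕ} (hwM : ∀ G : Face M i, wM G.1 ≠ 0)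
    (hw : ∀ F ∈ K, wK F = wM (F.image φ))
    {ψ : PermVoltage (incidenceGraph M i) k} (η : DerivedIso K M φ ψ) {m : ℕ} {d : Fin m → ℕ}
    (ρ : ∀ j, voltageGroup ψ →* Matrix (Fin (d j)) (Fin (d j)) ℂ)
    (e : Fin k ≃ Unit ⊕ Σ j, Fin (d j)) {T : Matrix (Fin k) (Fin k) ℂ} (hT : IsUnit T)
    (hrep : ∀ g : voltageGroup ψ, T⁻¹ * permutationMatrix (g : Equiv.Perm (Fin k)) * T =
      (directSum (1 : Matrix Unit Unit ℂ) fun j => ρ j g).submatrix e e) :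
    ((1 : Matrix (Face M i) (Face M i) ℂ) ⊗ₖ T)⁻¹
        * toComplex (signature oK oM η)
        * toComplex ((upLaplacian oK wK i).submatrix η.lower η.lower)
        * (toComplex (signature oK oM η))⁻¹
        * ((1 : Matrix (Face M i) (Face M i) ℂ) ⊗ₖ T) =
      (directSum (toComplex (upLaplacian oM wM i)) fun j =>
        twistedUpLaplacian oM wM ψ (ρ j)).submatrix
          (blockEquiv (Face M i) e) (blockEquiv (Face M i) e) := by
  have hconj := one_kronecker_conj_twistedUpLaplacian oM wM ψ
    (fun g => permutationMatrix (g : Equiv.Perm (Fin k))) hT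
  simp only [hrep] at hconj
  rw [twistedUpLaplacian_directSum, ← signature_conj_upLaplacian oM η oK hwM hw] at hconj
  simpa only [Matrix.mul_assoc] using hconj

theorem theorem1p4
    {V U : Type*} [Fintype V] [DecidableEq V] [Fintype U] [DecidableEq U]
    {K : AbstractSimplicialComplex V} {M : AbstractSimplicialComplex U}
    (oK : FaceOrientation K) (oM : FaceOrientation M)
    (wK : Finset V → ℝ) (wM : Finset U → ℝ)
    (hwK : ∀ F ∈ K, 0 < wK F) (hwM : ∀ G ∈ M, 0 < wM G)
    (φ : V → U) (k : ℕ) (hφ : IsFoldCovering k K M φ)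
    (hw : ∀ F ∈ K, wK F = wM (F.image φ))
    (i : ℕ) (ψ : PermVoltage (incidenceGraph M i) k) (η : DerivedIso K M φ ψ)
    (m : ℕ) (d : Fin m → ℕ)
    (ρ : ∀ j, voltageGroup ψ →* Matrix (Fin (d j)) (Fin (d j)) ℂ)
    (hρ : ∀ j, (matrixRep (ρ j)).IsIrreducible)
    (e : Fin k ≃ Unit ⊕ Σ j, Fin (d j))
    (T : Matrix (Fin k) (Fin k) ℂ) (hT : IsUnit T)
    (hrep : ∀ g : voltageGroup ψ, T⁻¹ * permutationMatrix (g : Equiv.Perm (Fin k)) * T =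
      (directSum (1 : Matrix Unit Unit ℂ) fun j => ρ j g).submatrix e e) :
    ((1 : Matrix (Face M i) (Face M i) ℂ) ⊗ₖ T)⁻¹
        * toComplex (signature oK oM η)
        * toComplex ((upLaplacian oK wK i).submatrix η.lower η.lower)
        * (toComplex (signature oK oM η))⁻¹
        * ((1 : Matrix (Face M i) (Face M i) ℂ) ⊗ₖ T) =
      (directSum (toComplex (upLaplacian oM wM i)) fun j =>
          (∑ g : voltageGroup ψ,
            toComplex ((weightMatrix M wM i)⁻¹ * (coboundaryPart oM ψ (g : Equiv.Perm (Fin k)))ᵀ)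
              ⊗ₖ ρ j g⁻¹)
          * (∑ g : voltageGroup ψ,
            toComplex (weightMatrix M wM (i + 1) * coboundaryPart oM ψ (g : Equiv.Perm (Fin k)))
              ⊗ₖ ρ j g)).submatrix (blockEquiv (Face M i) e) (blockEquiv (Face M i) e) :=
  theorem1p4_general oK oM (fun G => (hwM G.1 G.2.1).ne') hw η ρ e hT hrep
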